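/- Let $x,y\in\mathbb{R}$ satisfy $x^2+y^2-x-y+xy=0$ and $-\tfrac13\le x\le 1$, and let $$C=\begin{pmatrix} x & y & 1-x-y\\ 1-x-y & x & y\\ y & 1-x-y & x\end{pmatrix}$$ (the set of all such matrices is denoted $\mathcal{X}$). Assume $x\neq 0,1$. Consider the three-state discrete-time quantum walk on $\mathbb{Z}$ with coin $C$: on $\ell^2(\mathbb{Z})\otimes\mathbb{C}^3$ one step is $U=\mathsf{S}(I\otimes C)$, where $$\mathsf{S}=\sum_{m\in\mathbb{Z}}\bigl(|m-1\rangle\langle m|\otimes|1\rangle\langle 1|+|m\rangle\langle m|\otimes|2\rangle\langle 2|+|m+1\rangle\langle m|\otimes|3\rangle\langle 3|\bigr).$$ The walk starts at the origin, $\psi(0)=|0\rangle\otimes(\alpha,\beta,\gamma)^T$ with $\alpha,\beta,\gamma\in\mathbb{C}$, $|\alpha|^2+|\beta|^2+|\gamma|^2=1$; put $\psi(t)=U^t\psi(0)=\sum_{m,l}\psi_l(m,t)\,|m\rangle\otimes|l\rangle$ and $P(m,t)=\sum_{l=1}^3|\psi_l(m,t)|^2$. Then the following are equivalent: 1. $\lim_{t\to\infty}P(0,t)=0$;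 2. $(\alpha,\beta,\gamma)^T$ is a complex multiple of $(1-x-y,\,-(1-x),\,y)^T$; 3. $(\alpha,\beta,\gamma)^T=\frac{u}{N}\,(1-x-y,\,-(1-x),\,y)^T$ for some $u\in\mathbb{C}$ with $|u|=1$, where $N=\sqrt{(1-x-y)^2+(1-x)^2+y^2}$; 4. $A=B=0$, where $A=\alpha(1-x)+\beta(1-x-y)$ and $B=\gamma(1-x)+\beta y$. For every other initial coin state the walk localizes at the origin, that is, $\lim_{t\to\infty}P(0,t)$ exists and is positive. -/

import Mathlib

/-! Three-state discrete-time quantum walk on the line. -/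

noncomputable section

namespace ThreeStateWalk

/-- The coin space `ℂ³` with its Hermitian norm; the coordinates `0, 1, 2` are the chiralities
left, centre and right. -/
abbrev CoinSpace : Type := EuclideanSpace ℂ (Fin 3)

/-- The state space `ℓ²(ℤ) ⊗ ℂ³`, realised as `ℓ²(ℤ; ℂ³)`: the vector `f m` collects the three
probability amplitudes at the position `m`. -/
abbrev StateSpace : Type := lp (fun _ : ℤ => CoinSpace) 2

theorem memlp_iff (f : ℤ → CoinSpace) :
    Memℓp f 2 ↔ Summable fun m => ‖f m‖ ^ 2 := by
  rw [memℓp_gen_iff (by norm_num)]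
  norm_num

theorem memlp_coin (C : Matrix (Fin 3) (Fin 3) ℂ) (f : StateSpace) :
    Memℓp (fun m => Matrix.toEuclideanCLM (𝕜 := ℂ) C (f m)) 2 := by
  rw [memlp_iff]
  have hf := ((memlp_iff f).1 f.2).mul_left (‖Matrix.toEuclideanCLM (𝕜 := ℂ) C‖ ^ 2)
  refine Summable.of_nonneg_of_le (fun m => by positivity) (fun m => ?_) hf
  rw [← mul_pow]
  gcongr
  exact ContinuousLinearMap.le_opNorm _ _

theorem norm_shift_sq_le (u v w : CoinSpace) :
    ‖(!₂[u 0, v 1, w 2] : CoinSpace)‖ ^ 2 ≤ ‖u‖ ^ 2 + ‖v‖ ^ 2 + ‖w‖ ^ 2 := by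
  have hu := PiLp.norm_apply_le u 0
  have hv := PiLp.norm_apply_le v 1
  have hw := PiLp.norm_apply_le w 2
  have h : ‖(!₂[u 0, v 1, w 2] : CoinSpace)‖ ^ 2 = ‖u 0‖ ^ 2 + ‖v 1‖ ^ 2 + ‖w 2‖ ^ 2 := by
    simp [EuclideanSpace.norm_sq_eq, Fin.sum_univ_three]
  rw [h]
  gcongr

theorem memlp_shift (f : StateSpace) :
    Memℓp (fun m : ℤ => (!₂[f (m + 1) 0, f m 1, f (m - 1) 2] : CoinSpace)) 2 := by
  rw [memlp_iff]
  have hf := (memlp_iff f).1 f.2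
  have h1 : Summable fun m : ℤ => ‖f (m + 1)‖ ^ 2 :=
    hf.comp_injective (add_left_injective (1 : ℤ))
  have h2 : Summable fun m : ℤ => ‖f (m - 1)‖ ^ 2 :=
    hf.comp_injective (sub_left_injective (b := (1 : ℤ)))
  exact Summable.of_nonneg_of_le (fun m => sq_nonneg _)
    (fun m => norm_shift_sq_le (f (m + 1)) (f m) (f (m - 1))) ((h1.add hf).add h2)

/-- The operator `I ⊗ C`: the coin `C` acts on the amplitude vector of every position. -/
def coinOp (C : Matrix (Fin 3) (Fin 3) ℂ) : StateSpace →ₗ[ℂ] StateSpace where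
  toFun f := ⟨fun m => Matrix.toEuclideanCLM (𝕜 := ℂ) C (f m), memlp_coin C f⟩
  map_add' f g := by
    ext1; funext m
    exact map_add (Matrix.toEuclideanCLM (𝕜 := ℂ) C) (f m) (g m)
  map_smul' c f := by
    ext1; funext m
    exact map_smul (Matrix.toEuclideanCLM (𝕜 := ℂ) C) c (f m)

/-- The conditional shift
`S = ∑ₘ (|m-1⟩⟨m| ⊗ |1⟩⟨1| + |m⟩⟨m| ⊗ |2⟩⟨2| + |m+1⟩⟨m| ⊗ |3⟩⟨3|)`:
the left component at `m` comes from `m + 1`, the right component from `m - 1`. -/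
def shiftOp : StateSpace →ₗ[ℂ] StateSpace where
  toFun f := ⟨fun m => !₂[f (m + 1) 0, f m 1, f (m - 1) 2], memlp_shift f⟩
  map_add' f g := by
    ext m i
    fin_cases i <;> rfl
  map_smul' c f := by
    ext m i
    fin_cases i <;> rfl

/-- One step `U = S (I ⊗ C)` of the walk with coin `C`. -/
def stepOp (C : Matrix (Fin 3) (Fin 3) ℂ) : StateSpace →ₗ[ℂ] StateSpace :=
  shiftOp ∘ₗ coinOp C

/-- The state `ψ(t) = Uᵗ ψ(0)` of the walk that starts at the origin with coin state `φ`, that is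
with `ψ(0) = |0⟩ ⊗ φ`. -/
def state (C : Matrix (Fin 3) (Fin 3) ℂ) (φ : CoinSpace) (t : ℕ) : StateSpace :=
  (stepOp C ^ t) (lp.single 2 0 φ)

/-- The probability `P(m, t) = ∑ₗ |ψₗ(m, t)|²` of finding the walker at `m` at time `t`. -/
def prob (C : Matrix (Fin 3) (Fin 3) ℂ) (φ : CoinSpace) (m : ℤ) (t : ℕ) : ℝ :=
  ∑ l : Fin 3, ‖state C φ t m l‖ ^ 2

/-- The walk localizes at `m`: the limit of `P(m, t)` as `t → ∞` exists and is positive. -/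
def LocalizesAt (C : Matrix (Fin 3) (Fin 3) ℂ) (φ : CoinSpace) (m : ℤ) : Prop :=
  ∃ p : ℝ, 0 < p ∧ Filter.Tendsto (fun t : ℕ => prob C φ m t) Filter.atTop (nhds p)

/-- The matrix with parameters `x, y`. -/
def coin (x y : ℝ) : Matrix (Fin 3) (Fin 3) ℂ :=
  !![(x : ℂ), (y : ℂ), 1 - x - y;
     1 - x - y, (x : ℂ), (y : ℂ);
     (y : ℂ), 1 - x - y, (x : ℂ)]

/-- The family `𝒳` of generalized Grover coins. -/
def coinsX : Set (Matrix (Fin 3) (Fin 3) ℂ) :=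
  {C | ∃ x y : ℝ, x ^ 2 + y ^ 2 - x - y + x * y = 0 ∧ -(1 / 3) ≤ x ∧ x ≤ 1 ∧ C = coin x y}

/-- The vector `(1 - x - y, -(1 - x), y)ᵀ`. -/
def escapeVec (x y : ℝ) : CoinSpace :=
  !₂[(1 - x - y : ℂ), -(1 - x : ℂ), (y : ℂ)]

end ThreeStateWalk

end

/-! The Fourier transform in position turns the walk into a family of unitary `3 × 3` matrices
`U k`, `k ∈ [-π, π]`. Each `U k` has the eigenvalue `1`, with an eigenvector `v k` that is affine in
`exp (i k)`, and two further eigenvalues `exp (± i θ k)`, where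
`cos (θ k) = (x (1 + 2 cos k) - 1) / 2`. Since `x ≠ 0`, the phase `θ` is not stationary away from
`k = 0, ± π`, so by the Riemann–Lebesgue lemma the components with these eigenvalues vanish in the
limit. Hence the amplitude at the origin tends to the mean over `k` of the projection `P k φ` of the
initial coin state `φ` to the line through `v k`. Its inner product with `φ` is the mean of
`‖P k φ‖ ^ 2`, so it vanishes if and only if `φ` is orthogonal to every `v k`. As
`⟪v k, φ⟫ = A exp (- i k) + B`, this means `A = B = 0`. -/

open MeasureTheory Filter Topology Complex
open scoped Real InnerProductSpace

section QuadraticOperator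

variable {K V : Type*} [Field K] [AddCommGroup V] [Module K V]

/-- The component in the `μ`-eigenspace of `U` of a vector `w` annihilated by `(U - μ) (U - ν)`,
for `μ ≠ ν`. -/
def eigencomponent (U : Module.End K V) (μ ν : K) (w : V) : V :=
  (μ - ν)⁻¹ • (U w - ν • w)

variable {U : Module.End K V} {μ ν : K} {w : V}

theorem apply_eigencomponent (h : U (U w) = (μ + ν) • U w - (μ * ν) • w) :
    U (eigencomponent U μ ν w) = μ • eigencomponent U μ ν w := by
  rw [eigencomponent, map_smul, map_sub, map_smul, h, smul_comm μ]
  congr 1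
  module

theorem eigencomponent_add_eigencomponent (hne : μ ≠ ν) :
    eigencomponent U μ ν w + eigencomponent U ν μ w = w := by
  have hsub : μ - ν ≠ 0 := sub_ne_zero.2 hne
  rw [eigencomponent, eigencomponent, ← neg_sub μ ν, inv_neg, neg_smul, ← sub_eq_add_neg,
    ← smul_sub, inv_smul_eq_iff₀ hsub]
  module

theorem pow_apply_of_apply_eq_smul (h : U w = μ • w) (t : ℕ) : (U ^ t) w = μ ^ t • w := by
  induction t with
  | zero => simp
  | succ t ih => rw [pow_succ', Module.End.mul_apply, ih, map_smul, h, smul_smul, pow_succ]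

theorem pow_apply_eq_smul_eigencomponent_add (hne : μ ≠ ν)
    (h : U (U w) = (μ + ν) • U w - (μ * ν) • w) (t : ℕ) :
    (U ^ t) w = μ ^ t • eigencomponent U μ ν w + ν ^ t • eigencomponent U ν μ w := by
  have h' : U (U w) = (ν + μ) • U w - (ν * μ) • w := by rw [h, add_comm, mul_comm]
  conv_lhs => rw [← eigencomponent_add_eigencomponent (U := U) (w := w) hne]
  rw [map_add, pow_apply_of_apply_eq_smul (apply_eigencomponent h),
    pow_apply_of_apply_eq_smul (apply_eigencomponent h')]

end QuadraticOperator

section InnerPreserving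

variable {𝕜 E : Type*} [RCLike 𝕜] [NormedAddCommGroup E] [InnerProductSpace 𝕜 E]
  {U : Module.End 𝕜 E} {μ ν : 𝕜}

theorem inner_eq_zero_of_apply_eq_smul_of_ne (hU : ∀ a b, ⟪U a, U b⟫_𝕜 = ⟪a, b⟫_𝕜)
    (hμ : ‖μ‖ = 1) (hne : μ ≠ ν) {p q : E} (hp : U p = μ • p) (hq : U q = ν • q) :
    ⟪p, q⟫_𝕜 = 0 := by
  have hinner : (starRingEnd 𝕜 μ * ν - 1) * ⟪p, q⟫_𝕜 = 0 := by
    have hpq := hU p q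
    rw [hp, hq, inner_smul_left, inner_smul_right] at hpq
    linear_combination hpq
  have hμμ : μ * starRingEnd 𝕜 μ = 1 := by simp [RCLike.mul_conj, hμ]
  refine (mul_eq_zero.1 hinner).resolve_left fun hone => hne ?_
  linear_combination ν * hμμ - μ * hone

theorem norm_eigencomponent_le (hU : ∀ a b, ⟪U a, U b⟫_𝕜 = ⟪a, b⟫_𝕜) (hμ : ‖μ‖ = 1)
    (hne : μ ≠ ν) {w : E} (h : U (U w) = (μ + ν) • U w - (μ * ν) • w) :
    ‖eigencomponent U μ ν w‖ ≤ ‖w‖ := by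
  have h' : U (U w) = (ν + μ) • U w - (ν * μ) • w := by rw [h, add_comm, mul_comm]
  have horth := inner_eq_zero_of_apply_eq_smul_of_ne hU hμ hne
    (apply_eigencomponent h) (apply_eigencomponent h')
  have hpyth := norm_add_sq_eq_norm_sq_add_norm_sq_of_inner_eq_zero _ _ horth
  rw [eigencomponent_add_eigencomponent hne] at hpyth
  nlinarith [norm_nonneg w, mul_self_nonneg ‖eigencomponent U ν μ w‖]

end InnerPreserving

section UnitVector

variable {𝕜 E : Type*} [RCLike 𝕜] [NormedAddCommGroup E] [NormedSpace 𝕜 E]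

theorem exists_eq_smul_iff_exists_norm_eq_one {w v : E} (hw : ‖w‖ = 1) :
    (∃ c : 𝕜, w = c • v) ↔ ∃ u : 𝕜, ‖u‖ = 1 ∧ w = (u / (‖v‖ : 𝕜)) • v := by
  refine ⟨?_, fun ⟨u, _, hu⟩ => ⟨_, hu⟩⟩
  rintro ⟨c, rfl⟩
  have hv : (‖v‖ : 𝕜) ≠ 0 := by
    rintro hv
    simp_all
  refine ⟨c * ‖v‖, ?_, by rw [mul_div_cancel_right₀ _ hv]⟩
  rwa [norm_mul, RCLike.norm_ofReal, abs_norm, ← norm_smul]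

end UnitVector

theorem tendsto_setIntegral_circleExp_smul_cocompact {E : Type*} [NormedAddCommGroup E]
    [NormedSpace ℂ E] {s : Set ℝ} (hs : MeasurableSet s) {θ θ' : ℝ → ℝ}
    (hθ : ∀ k ∈ s, HasDerivWithinAt θ (θ' k) s k) (hinj : Set.InjOn θ s)
    (hθ' : ∀ k ∈ s, θ' k ≠ 0) (f : ℝ → E) :
    Tendsto (fun t : ℝ => ∫ k in s, Circle.exp (t * θ k) • f k) (cocompact ℝ) (𝓝 0) := by
  -- Substituting `u = θ k` turns the integral into a Fourier transform at `-t / (2π)`.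
  set g := Function.invFunOn θ s
  have hg : ∀ k ∈ s, g (θ k) = k := fun k hk => hinj.leftInvOn_invFunOn hk
  set F : ℝ → E := (θ '' s).indicator fun u => |θ' (g u)|⁻¹ • f (g u)
  have hscale : Tendsto (fun t : ℝ => -(2 * π)⁻¹ * t) (cocompact ℝ) (cocompact ℝ) :=
    (Homeomorph.mulLeft₀ (-(2 * π)⁻¹)
      (neg_ne_zero.2 (by positivity))).isClosedEmbedding.tendsto_cocompact
  refine ((Real.tendsto_integral_exp_smul_cocompact F).comp hscale).congr fun t => ?_
  have hkernel : (fun u : ℝ => Real.fourierChar (-(u * (-(2 * π)⁻¹ * t))) • F u) =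
      (θ '' s).indicator fun u => Circle.exp (t * u) • |θ' (g u)|⁻¹ • f (g u) := by
    rw [Set.indicator_smul]
    funext u
    rw [Real.fourierChar_apply']
    congr 2
    field_simp
  have himage : MeasurableSet (θ '' s) :=
    measurable_image_of_fderivWithin hs (fun k hk => (hθ k hk).hasFDerivWithinAt) hinj
  rw [Function.comp_apply, hkernel, integral_indicator himage,
    integral_image_eq_integral_abs_deriv_smul hs hθ hinj]
  refine setIntegral_congr_fun hs fun k hk => ?_
  have hne : |θ' k| ≠ 0 := abs_ne_zero.2 (hθ' k hk)
  simp only [hg k hk]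
  rw [smul_comm, smul_inv_smul₀ hne]

section OscillatingFamily

variable {E : Type*} [NormedAddCommGroup E] [InnerProductSpace ℂ E] {U : ℝ → Module.End ℂ E}
  {w : ℝ → E} {s : Set ℝ}

theorem integrableOn_circle_smul (hs : MeasurableSet s) {μ : ℝ → Circle} (hμ : ContinuousOn μ s)
    (hw : IntegrableOn w s) : IntegrableOn (fun k => μ k • w k) s := by
  have hμc : ContinuousOn (fun k => (μ k : ℂ)) s := by fun_prop
  exact hw.integrable.mono ((hμc.aestronglyMeasurable hs).smul hw.aestronglyMeasurable)
    (Eventually.of_forall fun _ => (Circle.norm_smul _ _).le)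

theorem integrableOn_eigencomponent (hs : MeasurableSet s) {μ ν : ℝ → Circle}
    (hμ : ContinuousOn μ s) (hν : ContinuousOn ν s) (hne : ∀ k ∈ s, μ k ≠ ν k)
    (hU : ∀ k ∈ s, ∀ a b, ⟪U k a, U k b⟫_ℂ = ⟪a, b⟫_ℂ) (hw : IntegrableOn w s)
    (hUw : AEStronglyMeasurable (fun k => U k (w k)) (volume.restrict s))
    (hquad : ∀ k ∈ s, U k (U k (w k)) =
      (μ k + ν k : ℂ) • U k (w k) - (μ k * ν k : ℂ) • w k) :
    IntegrableOn (fun k => eigencomponent (U k) (μ k : ℂ) (ν k) (w k)) s := by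
  have hμc : ContinuousOn (fun k => (μ k : ℂ)) s := by fun_prop
  have hνc : ContinuousOn (fun k => (ν k : ℂ)) s := by fun_prop
  have hne' : ∀ k ∈ s, (μ k : ℂ) ≠ ν k := fun k hk => Circle.coe_injective.ne (hne k hk)
  have hinv : ContinuousOn (fun k => (μ k - ν k : ℂ)⁻¹) s :=
    (hμc.sub hνc).inv₀ fun k hk => sub_ne_zero.2 (hne' k hk)
  have hmeas : AEStronglyMeasurable (fun k => eigencomponent (U k) (μ k : ℂ) (ν k) (w k))
      (volume.restrict s) :=
    (hinv.aestronglyMeasurable hs).smul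
      (hUw.sub ((hνc.aestronglyMeasurable hs).smul hw.aestronglyMeasurable))
  refine hw.integrable.mono hmeas ((ae_restrict_iff' hs).2 (Eventually.of_forall fun k hk => ?_))
  exact norm_eigencomponent_le (hU k hk) (Circle.norm_coe _) (hne' k hk) (hquad k hk)

theorem setIntegral_pow_apply_eq_add (hs : MeasurableSet s) {μ ν : ℝ → Circle}
    (hμ : ContinuousOn μ s) (hν : ContinuousOn ν s) (hne : ∀ k ∈ s, μ k ≠ ν k)
    (hU : ∀ k ∈ s, ∀ a b, ⟪U k a, U k b⟫_ℂ = ⟪a, b⟫_ℂ) (hw : IntegrableOn w s)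
    (hUw : AEStronglyMeasurable (fun k => U k (w k)) (volume.restrict s))
    (hquad : ∀ k ∈ s, U k (U k (w k)) =
      (μ k + ν k : ℂ) • U k (w k) - (μ k * ν k : ℂ) • w k) (t : ℕ) :
    ∫ k in s, (U k ^ t) (w k) =
      (∫ k in s, μ k ^ t • eigencomponent (U k) (μ k : ℂ) (ν k) (w k)) +
        ∫ k in s, ν k ^ t • eigencomponent (U k) (ν k : ℂ) (μ k) (w k) := by
  have hquad' : ∀ k ∈ s, U k (U k (w k)) =
      (ν k + μ k : ℂ) • U k (w k) - (ν k * μ k : ℂ) • w k := fun k hk => by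
    rw [hquad k hk, add_comm (μ k : ℂ), mul_comm (μ k : ℂ)]
  have hp := integrableOn_eigencomponent hs hμ hν hne hU hw hUw hquad
  have hq := integrableOn_eigencomponent hs hν hμ (fun k hk => (hne k hk).symm) hU hw hUw hquad'
  rw [← integral_add (integrableOn_circle_smul (μ := fun k => μ k ^ t) hs (by fun_prop) hp)
    (integrableOn_circle_smul (μ := fun k => ν k ^ t) hs (by fun_prop) hq)]
  exact setIntegral_congr_fun hs fun k hk =>
    pow_apply_eq_smul_eigencomponent_add (Circle.coe_injective.ne (hne k hk)) (hquad k hk) t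

theorem tendsto_setIntegral_pow_apply_zero (hs : MeasurableSet s) {θ θ' : ℝ → ℝ}
    (hθ : ∀ k ∈ s, HasDerivWithinAt θ (θ' k) s k) (hinj : Set.InjOn θ s)
    (hθ' : ∀ k ∈ s, θ' k ≠ 0) (hsin : ∀ k ∈ s, Real.sin (θ k) ≠ 0)
    (hU : ∀ k ∈ s, ∀ a b, ⟪U k a, U k b⟫_ℂ = ⟪a, b⟫_ℂ) (hw : IntegrableOn w s)
    (hUw : AEStronglyMeasurable (fun k => U k (w k)) (volume.restrict s))
    (hquad : ∀ k ∈ s, U k (U k (w k)) = ((2 * Real.cos (θ k) : ℝ) : ℂ) • U k (w k) - w k) :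
    Tendsto (fun t : ℕ => ∫ k in s, (U k ^ t) (w k)) atTop (𝓝 0) := by
  have hθc : ContinuousOn θ s := fun k hk => (hθ k hk).continuousWithinAt
  have hne : ∀ k ∈ s, Circle.exp (θ k) ≠ Circle.exp (-θ k) := fun k hk h => hsin k hk <| by
    have him := congrArg (fun z : Circle => (z : ℂ).im) h
    simp only [Circle.coe_exp, exp_ofReal_mul_I_im, Real.sin_neg] at him
    linarith
  have hquad' : ∀ k ∈ s, U k (U k (w k)) =
      (Circle.exp (θ k) + Circle.exp (-θ k) : ℂ) • U k (w k) -
        (Circle.exp (θ k) * Circle.exp (-θ k) : ℂ) • w k := fun k hk => by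
    rw [hquad k hk, ← Circle.coe_mul, ← Circle.exp_add, add_neg_cancel, Circle.exp_zero,
      Circle.coe_one, one_smul, Circle.coe_exp, Circle.coe_exp, ofReal_neg, ← Complex.two_cos]
    push_cast
    rfl
  have hRL := tendsto_setIntegral_circleExp_smul_cocompact (E := E) hs hθ hinj hθ'
  have hplus := (hRL fun k =>
      eigencomponent (U k) (Circle.exp (θ k) : ℂ) (Circle.exp (-θ k)) (w k)).comp
    (tendsto_natCast_atTop_atTop.mono_right atTop_le_cocompact)
  have hminus := (hRL fun k =>
      eigencomponent (U k) (Circle.exp (-θ k) : ℂ) (Circle.exp (θ k)) (w k)).comp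
    ((tendsto_neg_atTop_atBot.comp tendsto_natCast_atTop_atTop).mono_right atBot_le_cocompact)
  rw [← add_zero (0 : E)]
  refine (hplus.add hminus).congr fun t => ?_
  rw [setIntegral_pow_apply_eq_add hs (by fun_prop) (by fun_prop) hne hU hw hUw hquad' t]
  simp only [Function.comp_apply, neg_mul, ← mul_neg, Circle.exp_natCast_mul]

end OscillatingFamily

theorem intervalIntegral_starProjection_eq_zero_iff {E : Type*} [NormedAddCommGroup E]
    [InnerProductSpace ℂ E] [CompleteSpace E] {a b : ℝ} (hab : a < b)
    {K : ℝ → Submodule ℂ E} [∀ k, (K k).HasOrthogonalProjection] {v : E}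
    (hcont : ContinuousOn (fun k => (K k).starProjection v) (Set.Icc a b)) :
    ∫ k in a..b, (K k).starProjection v = 0 ↔ ∀ k ∈ Set.Icc a b, (K k).starProjection v = 0 := by
  -- Pairing with `v` turns the vector integral into the integral of `‖(K k).starProjection v‖ ^ 2`.
  have hinner : ∀ k, ⟪v, (K k).starProjection v⟫_ℂ = ((‖(K k).starProjection v‖ ^ 2 : ℝ) : ℂ) :=
    fun k => by
      conv_lhs => rw [← Submodule.starProjection_eq_self_iff.2 ((K k).starProjection_apply_mem v)]
      rw [← Submodule.inner_starProjection_left_eq_right, inner_self_eq_norm_sq_to_K]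
      simp
  have hnorm : ⟪v, ∫ k in a..b, (K k).starProjection v⟫_ℂ =
      ((∫ k in a..b, ‖(K k).starProjection v‖ ^ 2 : ℝ) : ℂ) := by
    rw [← intervalIntegral.integral_ofReal, ← innerSL_apply_apply ℂ,
      ← ContinuousLinearMap.intervalIntegral_comp_comm _
        (hcont.intervalIntegrable_of_Icc hab.le)]
    simp only [innerSL_apply_apply, hinner]
  constructor
  · intro hzero k hk
    by_contra hne
    rw [hzero, inner_zero_right] at hnorm
    have hpos : 0 < ∫ k in a..b, ‖(K k).starProjection v‖ ^ 2 :=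
      intervalIntegral.integral_pos hab (hcont.norm.pow 2) (fun _ _ => sq_nonneg _)
        ⟨k, hk, by positivity⟩
    exact hpos.ne (by exact_mod_cast hnorm)
  · intro hzero
    rw [intervalIntegral.integral_congr (g := fun _ => (0 : E)) fun k hk =>
      hzero k (Set.uIcc_of_le hab.le ▸ hk), intervalIntegral.integral_zero]

namespace ThreeStateWalk

section InverseFourier

variable {E F : Type*} [NormedAddCommGroup E] [NormedSpace ℂ E]
  [NormedAddCommGroup F] [NormedSpace ℂ F]

/-- The amplitude at the position `m` of the wave packet with amplitude `g k` at the wave number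
`k ∈ [-π, π]`. -/
noncomputable def inverseFourier (g : ℝ → E) (m : ℤ) : E :=
  (2 * π : ℂ)⁻¹ • ∫ k in -π..π, Circle.exp k ^ m • g k

theorem integral_circleExp_zpow (m : ℤ) :
    ∫ k in -π..π, ((Circle.exp k ^ m : Circle) : ℂ) = if m = 0 then 2 * (π : ℂ) else 0 := by
  split_ifs with hm
  · simp only [hm, zpow_zero, Circle.coe_one, intervalIntegral.integral_const, sub_neg_eq_add,
      real_smul, ofReal_add, mul_one, two_mul]
  · have hc : (m : ℂ) * I ≠ 0 := mul_ne_zero (Int.cast_ne_zero.2 hm) I_ne_zero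
    have hexp : ∀ k : ℝ, ((Circle.exp k ^ m : Circle) : ℂ) = exp (m * I * k) := fun k => by
      rw [Circle.coe_zpow, Circle.coe_exp, ← exp_int_mul]
      ring_nf
    simp only [hexp]
    rw [integral_exp_mul_complex hc, div_eq_zero_iff, sub_eq_zero, exp_eq_exp_iff_exists_int]
    exact .inl ⟨m, by push_cast; ring⟩

theorem inverseFourier_const [CompleteSpace E] (φ : E) (m : ℤ) :
    inverseFourier (fun _ => φ) m = if m = 0 then φ else 0 := by
  have hpi : (2 * π : ℂ) ≠ 0 := mul_ne_zero two_ne_zero (ofReal_ne_zero.2 Real.pi_ne_zero)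
  simp only [inverseFourier, Circle.smul_def]
  rw [intervalIntegral.integral_smul_const, integral_circleExp_zpow, ite_smul, zero_smul,
    smul_ite, inv_smul_smul₀ hpi, smul_zero]

theorem inverseFourier_add_index (g : ℝ → E) (m n : ℤ) :
    inverseFourier g (m + n) = inverseFourier (fun k => Circle.exp k ^ n • g k) m := by
  simp only [inverseFourier, zpow_add, mul_smul]

theorem map_inverseFourier [CompleteSpace E] [CompleteSpace F] (L : E →L[ℂ] F) {g : ℝ → E}
    (hg : Continuous g) (m : ℤ) :
    L (inverseFourier g m) = inverseFourier (fun k => L (g k)) m := by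
  have hcont : Continuous fun k => Circle.exp k ^ m • g k := by fun_prop
  rw [inverseFourier, map_smul, ← L.intervalIntegral_comp_comm (hcont.intervalIntegrable _ _)]
  simp only [inverseFourier, Circle.smul_def, map_smul]

end InverseFourier

section MomentumSpace

variable {C : Matrix (Fin 3) (Fin 3) ℂ}

/-- The component `i` of the state at the position `m` is fed from `m + sourceOffset i`. -/
def sourceOffset : Fin 3 → ℤ := ![1, 0, -1]

theorem stepOp_apply (C : Matrix (Fin 3) (Fin 3) ℂ) (f : StateSpace) (m : ℤ) (i : Fin 3) :
    stepOp C f m i = Matrix.toEuclideanCLM (𝕜 := ℂ) C (f (m + sourceOffset i)) i := by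
  fin_cases i
  · rfl
  · exact congrArg (fun n => Matrix.toEuclideanCLM (𝕜 := ℂ) C (f n) 1) (add_zero m).symm
  · rfl

/-- One step of the walk on the waves of wave number `k`, written in terms of `z = exp (i k)`. -/
noncomputable def momentumStep (C : Matrix (Fin 3) (Fin 3) ℂ) (z : Circle) :
    Module.End ℂ CoinSpace :=
  (Matrix.toEuclideanCLM (𝕜 := ℂ)
    (Matrix.diagonal (fun i => ((z ^ sourceOffset i : Circle) : ℂ)) * C)).toLinearMap

theorem momentumStep_apply (C : Matrix (Fin 3) (Fin 3) ℂ) (z : Circle) (v : CoinSpace)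
    (i : Fin 3) :
    momentumStep C z v i = z ^ sourceOffset i • Matrix.toEuclideanCLM (𝕜 := ℂ) C v i := by
  rw [momentumStep, map_mul, Circle.smul_def, smul_eq_mul]
  exact Matrix.mulVec_diagonal (fun i => ((z ^ sourceOffset i : Circle) : ℂ)) _ i

theorem inner_momentumStep (hC : C ∈ Matrix.unitaryGroup (Fin 3) ℂ) (z : Circle)
    (a b : CoinSpace) : ⟪momentumStep C z a, momentumStep C z b⟫_ℂ = ⟪a, b⟫_ℂ := by
  have hdiag : Matrix.diagonal (fun i => ((z ^ sourceOffset i : Circle) : ℂ)) ∈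
      Matrix.unitaryGroup (Fin 3) ℂ := by
    rw [Matrix.mem_unitaryGroup_iff, Matrix.star_eq_conjTranspose, Matrix.diagonal_conjTranspose,
      Matrix.diagonal_mul_diagonal, Matrix.diagonal_eq_one]
    funext i
    rw [Pi.star_apply, RCLike.star_def, ← Circle.coe_inv_eq_conj, ← Circle.coe_mul,
      mul_inv_cancel, Circle.coe_one, Pi.one_apply]
  exact ContinuousLinearMap.inner_map_map_of_mem_unitary
    (Unitary.map_mem (Matrix.toEuclideanCLM (𝕜 := ℂ)) (mul_mem hdiag hC)) a b

theorem continuous_momentumStep_apply (C : Matrix (Fin 3) (Fin 3) ℂ) {g : ℝ → CoinSpace}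
    (hg : Continuous g) : Continuous fun k => momentumStep C (Circle.exp k) (g k) := by
  refine (PiLp.continuous_toLp 2 (fun _ : Fin 3 => ℂ)).comp (continuous_pi fun i => ?_)
  have hcoord : Continuous fun k =>
      Circle.exp k ^ sourceOffset i • Matrix.toEuclideanCLM (𝕜 := ℂ) C (g k) i := by fun_prop
  exact hcoord.congr fun k => (momentumStep_apply C _ _ i).symm

theorem continuous_momentumStep_pow_apply (C : Matrix (Fin 3) (Fin 3) ℂ) {g : ℝ → CoinSpace}
    (hg : Continuous g) (t : ℕ) :
    Continuous fun k => (momentumStep C (Circle.exp k) ^ t) (g k) := by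
  induction t with
  | zero => exact hg
  | succ t ih =>
    simpa only [pow_succ', Module.End.mul_apply] using continuous_momentumStep_apply C ih

theorem state_eq_inverseFourier (C : Matrix (Fin 3) (Fin 3) ℂ) (φ : CoinSpace) (t : ℕ) (m : ℤ) :
    state C φ t m = inverseFourier (fun k => (momentumStep C (Circle.exp k) ^ t) φ) m := by
  induction t generalizing m with
  | zero =>
    refine Eq.trans ?_ (inverseFourier_const φ m).symm
    split_ifs with hm
    · rw [hm]
      exact lp.single_apply_self (E := fun _ : ℤ => CoinSpace) 2 0 φ
    · exact lp.single_apply_ne (E := fun _ : ℤ => CoinSpace) 2 0 φ hm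
  | succ t ih =>
    have hcont := fun s => continuous_momentumStep_pow_apply C (continuous_const (y := φ)) s
    have hstep : state C φ (t + 1) = stepOp C (state C φ t) := by
      rw [state, pow_succ', Module.End.mul_apply, state]
    ext i
    let coord : CoinSpace →L[ℂ] ℂ := EuclideanSpace.proj i
    calc state C φ (t + 1) m i
        = (coord ∘L Matrix.toEuclideanCLM (𝕜 := ℂ) C)
            (inverseFourier (fun k => (momentumStep C (Circle.exp k) ^ t) φ)
              (m + sourceOffset i)) := by
          rw [hstep, stepOp_apply, ih]
          rfl
      _ = inverseFourier (fun k => coord ((momentumStep C (Circle.exp k) ^ (t + 1)) φ)) m := by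
          rw [map_inverseFourier _ (hcont t), inverseFourier_add_index]
          congr 1
          funext k
          rw [pow_succ', Module.End.mul_apply]
          exact (momentumStep_apply C _ _ i).symm
      _ = (inverseFourier (fun k => (momentumStep C (Circle.exp k) ^ (t + 1)) φ) m) i :=
          (map_inverseFourier coord (hcont (t + 1)) m).symm

end MomentumSpace

section Dispersion

variable {x : ℝ}

/-- The cosine of the argument of the two nontrivial eigenvalues of one step of the walk at the
wave number `k`. -/
noncomputable def dispersion (x k : ℝ) : ℝ := (x * (1 + 2 * Real.cos k) - 1) / 2

/-- The argument in `[0, π]` of a nontrivial eigenvalue of one step of the walk at the wave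
number `k`; the other nontrivial eigenvalue is the complex conjugate. -/
noncomputable def phase (x k : ℝ) : ℝ := Real.arccos (dispersion x k)

theorem dispersion_mem_Ico (hx : x ∈ Set.Ico (-(1 / 3)) 1) (k : ℝ) :
    dispersion x k ∈ Set.Ico (-1 : ℝ) 1 := by
  obtain ⟨hx_ge, hx_lt⟩ := hx
  have hcos := Real.cos_mem_Icc k
  constructor <;> unfold dispersion <;> nlinarith [hcos.1, hcos.2]

theorem neg_one_lt_dispersion (hx : x ∈ Set.Ico (-(1 / 3)) 1) {k : ℝ} (hk : Real.sin k ≠ 0) :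
    -1 < dispersion x k := by
  obtain ⟨hx_ge, hx_lt⟩ := hx
  have hcos_ge := Real.neg_one_le_cos k
  have hcos_lt : Real.cos k < 1 :=
    (Real.cos_le_one k).lt_of_ne fun h => hk (Real.sin_eq_zero_iff_cos_eq.2 (.inl h))
  unfold dispersion
  rcases le_total 0 x with _ | _ <;> nlinarith

theorem cos_phase (hx : x ∈ Set.Ico (-(1 / 3)) 1) (k : ℝ) :
    Real.cos (phase x k) = dispersion x k :=
  Real.cos_arccos (dispersion_mem_Ico hx k).1 (dispersion_mem_Ico hx k).2.le

theorem sin_phase_pos (hx : x ∈ Set.Ico (-(1 / 3)) 1) {k : ℝ} (hk : Real.sin k ≠ 0) :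
    0 < Real.sin (phase x k) :=
  Real.sin_pos_of_pos_of_lt_pi (Real.arccos_pos.2 (dispersion_mem_Ico hx k).2)
    (Real.arccos_lt_pi.2 (neg_one_lt_dispersion hx hk))

theorem hasDerivAt_dispersion (x k : ℝ) :
    HasDerivAt (dispersion x) (-(x * Real.sin k)) k :=
  ((((((Real.hasDerivAt_cos k).const_mul 2).const_add 1).const_mul x).sub_const 1).div_const
    2).congr_deriv (by ring)

theorem hasDerivAt_phase (hx : x ∈ Set.Ico (-(1 / 3)) 1) {k : ℝ} (hk : Real.sin k ≠ 0) :
    HasDerivAt (phase x) (x * Real.sin k / Real.sin (phase x k)) k := by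
  have harccos := Real.hasDerivAt_arccos (neg_one_lt_dispersion hx hk).ne'
    (dispersion_mem_Ico hx k).2.ne
  refine (harccos.comp k (hasDerivAt_dispersion x k)).congr_deriv ?_
  rw [phase, Real.sin_arccos]
  ring

theorem injOn_phase (hx : x ∈ Set.Ico (-(1 / 3)) 1) (hx0 : x ≠ 0) {s : Set ℝ}
    (hs : Set.InjOn Real.cos s) : Set.InjOn (phase x) s := fun k hk l hl hkl => by
  refine hs hk hl (mul_left_cancel₀ hx0 ?_)
  have hdisp : dispersion x k = dispersion x l := by rw [← cos_phase hx, hkl, cos_phase hx]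
  unfold dispersion at hdisp
  linarith

theorem tendsto_setIntegral_pow_apply_zero_of_phase {E : Type*} [NormedAddCommGroup E]
    [InnerProductSpace ℂ E] (hx : x ∈ Set.Ico (-(1 / 3)) 1) (hx0 : x ≠ 0)
    {U : ℝ → Module.End ℂ E} {w : ℝ → E} (hU : ∀ k a b, ⟪U k a, U k b⟫_ℂ = ⟪a, b⟫_ℂ)
    (hw : Continuous w) (hUw : Continuous fun k => U k (w k))
    (hquad : ∀ k, U k (U k (w k)) = ((2 * dispersion x k : ℝ) : ℂ) • U k (w k) - w k)
    {a b : ℝ} (hsin : ∀ k ∈ Set.Ioo a b, Real.sin k ≠ 0)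
    (hcos : Set.InjOn Real.cos (Set.Ioo a b)) :
    Tendsto (fun t : ℕ => ∫ k in Set.Ioo a b, (U k ^ t) (w k)) atTop (𝓝 0) :=
  tendsto_setIntegral_pow_apply_zero measurableSet_Ioo
    (fun k hk => (hasDerivAt_phase hx (hsin k hk)).hasDerivWithinAt) (injOn_phase hx hx0 hcos)
    (fun k hk => div_ne_zero (mul_ne_zero hx0 (hsin k hk)) (sin_phase_pos hx (hsin k hk)).ne')
    (fun k hk => (sin_phase_pos hx (hsin k hk)).ne') (fun k _ => hU k)
    ((hw.integrableOn_Icc (a := a) (b := b)).mono_set Set.Ioo_subset_Icc_self)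
    hUw.aestronglyMeasurable fun k _ => by rw [hquad, cos_phase hx]

theorem tendsto_intervalIntegral_pow_apply_zero {E : Type*} [NormedAddCommGroup E]
    [InnerProductSpace ℂ E] (hx : x ∈ Set.Ico (-(1 / 3)) 1) (hx0 : x ≠ 0)
    {U : ℝ → Module.End ℂ E} {w : ℝ → E} (hU : ∀ k a b, ⟪U k a, U k b⟫_ℂ = ⟪a, b⟫_ℂ)
    (hUw : ∀ t, Continuous fun k => (U k ^ t) (w k))
    (hquad : ∀ k, U k (U k (w k)) = ((2 * dispersion x k : ℝ) : ℂ) • U k (w k) - w k) :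
    Tendsto (fun t : ℕ => ∫ k in -π..π, (U k ^ t) (w k)) atTop (𝓝 0) := by
  have hlimit {a b : ℝ} := tendsto_setIntegral_pow_apply_zero_of_phase hx hx0 hU
    (by simpa using hUw 0) (by simpa using hUw 1) hquad (a := a) (b := b)
  have hleft := hlimit (a := -π) (b := 0)
    (fun k hk => (Real.sin_neg_of_neg_of_neg_pi_lt hk.2 hk.1).ne) fun k hk l hl hkl => by
      rw [← Real.cos_neg k, ← Real.cos_neg l] at hkl
      exact neg_injective (Real.injOn_cos ⟨by linarith [hk.2], by linarith [hk.1]⟩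
        ⟨by linarith [hl.2], by linarith [hl.1]⟩ hkl)
  have hright := hlimit (a := 0) (b := π) (fun k hk => (Real.sin_pos_of_mem_Ioo hk).ne')
    (Real.injOn_cos.mono Set.Ioo_subset_Icc_self)
  rw [← add_zero (0 : E)]
  refine (hleft.add hright).congr fun t => ?_
  rw [← integral_Ioc_eq_integral_Ioo, ← integral_Ioc_eq_integral_Ioo,
    ← intervalIntegral.integral_of_le (neg_nonpos.2 Real.pi_nonneg),
    ← intervalIntegral.integral_of_le Real.pi_nonneg,
    intervalIntegral.integral_add_adjacent_intervals ((hUw t).intervalIntegrable _ _)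
      ((hUw t).intervalIntegrable _ _)]

end Dispersion

section Coin

variable {x y : ℝ}

theorem mem_Icc_of_relation (h : x ^ 2 + y ^ 2 - x - y + x * y = 0) :
    x ∈ Set.Icc (-(1 / 3)) 1 := by
  have hsq : (1 - x) * (1 + 3 * x) = (2 * y + x - 1) ^ 2 := by linear_combination -4 * h
  constructor <;> nlinarith [hsq, sq_nonneg (2 * y + x - 1)]

theorem coin_mem_coinsX_iff :
    coin x y ∈ coinsX ↔ x ^ 2 + y ^ 2 - x - y + x * y = 0 := by
  refine ⟨?_, fun h => ⟨x, y, h, (mem_Icc_of_relation h).1, (mem_Icc_of_relation h).2, rfl⟩⟩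
  rintro ⟨x', y', h, -, -, hC⟩
  obtain rfl : x = x' := ofReal_injective (congrFun (congrFun hC 0) 0)
  obtain rfl : y = y' := ofReal_injective (congrFun (congrFun hC 0) 1)
  exact h

theorem coin_mem_unitaryGroup (h : x ^ 2 + y ^ 2 - x - y + x * y = 0) :
    coin x y ∈ Matrix.unitaryGroup (Fin 3) ℂ := by
  have h' : (x : ℂ) ^ 2 + y ^ 2 - x - y + x * y = 0 := by exact_mod_cast h
  rw [Matrix.mem_unitaryGroup_iff]
  ext i j
  fin_cases i <;> fin_cases j <;>
    simp [coin, Matrix.mul_apply, Fin.sum_univ_three] <;> grind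

theorem momentumStep_coin_apply (x y : ℝ) (z : Circle) (φ : CoinSpace) :
    momentumStep (coin x y) z φ =
      !₂[(z : ℂ) * ((x : ℂ) * φ 0 + (y : ℂ) * φ 1 + (1 - x - y : ℂ) * φ 2),
        (1 - x - y : ℂ) * φ 0 + (x : ℂ) * φ 1 + (y : ℂ) * φ 2,
        (z : ℂ)⁻¹ * ((y : ℂ) * φ 0 + (1 - x - y : ℂ) * φ 1 + (x : ℂ) * φ 2)] := by
  ext i
  rw [momentumStep_apply]
  fin_cases i <;>
    simp [sourceOffset, coin, Circle.smul_def, Matrix.mulVec, dotProduct, Fin.sum_univ_three,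
      mul_add]

/-- A vector fixed by one step of the walk with coin `coin x y` at the wave number `k`, where
`z = exp (i k)`. -/
noncomputable def fixedVec (x y : ℝ) (z : Circle) : CoinSpace :=
  !₂[(1 - x) * z, (1 - x - y) * z + y, 1 - x]

theorem momentumStep_fixedVec (h : x ^ 2 + y ^ 2 - x - y + x * y = 0) (z : Circle) :
    momentumStep (coin x y) z (fixedVec x y z) = fixedVec x y z := by
  have h' : (x : ℂ) ^ 2 + y ^ 2 - x - y + x * y = 0 := by exact_mod_cast h
  have hz := z.coe_ne_zero
  ext i
  rw [momentumStep_coin_apply]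
  fin_cases i <;> simp [fixedVec] <;> grind

theorem inner_fixedVec (x y : ℝ) (z : Circle) (φ : CoinSpace) :
    ⟪fixedVec x y z, φ⟫_ℂ =
      (z : ℂ)⁻¹ * (φ 0 * (1 - x) + φ 1 * (1 - x - y)) + (φ 2 * (1 - x) + φ 1 * y) := by
  simp [fixedVec, PiLp.inner_apply, Fin.sum_univ_three, ← Circle.coe_inv_eq_conj]
  ring

theorem forall_inner_fixedVec_eq_zero_iff {φ : CoinSpace} {s : Set Circle}
    (h1 : 1 ∈ s) (hneg : -1 ∈ s) :
    (∀ z ∈ s, ⟪fixedVec x y z, φ⟫_ℂ = 0) ↔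
      φ 0 * (1 - x) + φ 1 * (1 - x - y) = 0 ∧ φ 2 * (1 - x) + φ 1 * y = 0 := by
  simp only [inner_fixedVec]
  refine ⟨fun hzero => ?_, fun ⟨hA, hB⟩ z _ => by rw [hA, hB, mul_zero, add_zero]⟩
  have hone := hzero 1 h1
  have hneg_one := hzero (-1) hneg
  rw [Circle.coe_one] at hone
  rw [Circle.coe_neg, Circle.coe_one] at hneg_one
  constructor
  · linear_combination (hone - hneg_one) / 2
  · linear_combination (hone + hneg_one) / 2

/-- The left-hand side is `p(U) φ`, where `U` is the step operator and `(X - 1) p(X)` its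
characteristic polynomial, so by Cayley–Hamilton it lies on the line fixed by `U`. -/
theorem quadratic_momentumStep (h : x ^ 2 + y ^ 2 - x - y + x * y = 0) (z : Circle)
    (φ : CoinSpace) :
    (1 - x : ℂ) • (momentumStep (coin x y) z (momentumStep (coin x y) z φ) -
        (x * (1 + ((z : ℂ) + (z : ℂ)⁻¹)) - 1) • momentumStep (coin x y) z φ + φ) =
      ⟪fixedVec x y z, φ⟫_ℂ • fixedVec x y z := by
  have h' : (x : ℂ) ^ 2 + y ^ 2 - x - y + x * y = 0 := by exact_mod_cast h
  have hz := z.coe_ne_zero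
  rw [inner_fixedVec]
  ext i
  simp only [momentumStep_coin_apply]
  fin_cases i <;> simp [fixedVec] <;> grind

theorem circleExp_add_inv (k : ℝ) :
    (Circle.exp k : ℂ) + (Circle.exp k : ℂ)⁻¹ = ((2 * Real.cos k : ℝ) : ℂ) := by
  rw [← Circle.coe_inv, ← Circle.exp_neg, Circle.coe_exp, Circle.coe_exp, ofReal_neg,
    ← Complex.two_cos, ofReal_mul, ofReal_cos, ofReal_ofNat]

theorem momentumStep_momentumStep_of_inner_eq_zero (h : x ^ 2 + y ^ 2 - x - y + x * y = 0)
    (hx1 : x ≠ 1) {k : ℝ} {φ : CoinSpace} (hφ : ⟪fixedVec x y (Circle.exp k), φ⟫_ℂ = 0) :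
    momentumStep (coin x y) (Circle.exp k) (momentumStep (coin x y) (Circle.exp k) φ) =
      ((2 * dispersion x k : ℝ) : ℂ) • momentumStep (coin x y) (Circle.exp k) φ - φ := by
  have hne : (1 - x : ℂ) ≠ 0 := by exact_mod_cast sub_ne_zero.2 hx1.symm
  have hzero := quadratic_momentumStep h (Circle.exp k) φ
  rw [hφ, zero_smul, smul_eq_zero_iff_right hne, circleExp_add_inv] at hzero
  have hdisp : ((2 * dispersion x k : ℝ) : ℂ) = x * (1 + (2 * Real.cos k : ℝ)) - 1 := by
    rw [dispersion]
    push_cast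
    ring
  rw [hdisp, ← sub_eq_zero, ← hzero]
  abel

end Coin

section Limit

variable {x y : ℝ}

/-- The component of `φ` along `fixedVec x y z`, which does not evolve in time. -/
noncomputable def fixedPart (x y : ℝ) (φ : CoinSpace) (z : Circle) : CoinSpace :=
  (ℂ ∙ fixedVec x y z).starProjection φ

theorem fixedPart_eq_zero_iff {φ : CoinSpace} {z : Circle} :
    fixedPart x y φ z = 0 ↔ ⟪fixedVec x y z, φ⟫_ℂ = 0 := by
  rw [fixedPart, Submodule.starProjection_apply_eq_zero_iff,
    Submodule.mem_orthogonal_singleton_iff_inner_right]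

theorem inner_fixedVec_sub_fixedPart (x y : ℝ) (φ : CoinSpace) (z : Circle) :
    ⟪fixedVec x y z, φ - fixedPart x y φ z⟫_ℂ = 0 :=
  Submodule.mem_orthogonal_singleton_iff_inner_right.1
    (Submodule.sub_starProjection_mem_orthogonal φ)

theorem momentumStep_pow_fixedPart (h : x ^ 2 + y ^ 2 - x - y + x * y = 0) (φ : CoinSpace)
    (z : Circle) (t : ℕ) :
    (momentumStep (coin x y) z ^ t) (fixedPart x y φ z) = fixedPart x y φ z := by
  obtain ⟨c, hc⟩ := Submodule.mem_span_singleton.1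
    (Submodule.starProjection_apply_mem (ℂ ∙ fixedVec x y z) φ)
  have hfixed : momentumStep (coin x y) z (fixedPart x y φ z) = (1 : ℂ) • fixedPart x y φ z := by
    rw [fixedPart, ← hc, map_smul, momentumStep_fixedVec h, one_smul]
  rw [pow_apply_of_apply_eq_smul hfixed, one_pow, one_smul]

theorem fixedVec_ne_zero (hx1 : x ≠ 1) (y : ℝ) (z : Circle) : fixedVec x y z ≠ 0 := fun hzero => by
  have hcoord : (1 - x : ℂ) = 0 := congrArg (fun v : CoinSpace => v 2) hzero
  exact sub_ne_zero.2 hx1.symm (by exact_mod_cast hcoord)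

theorem continuous_fixedPart (hx1 : x ≠ 1) (y : ℝ) (φ : CoinSpace) :
    Continuous (fixedPart x y φ) := by
  have hvec : Continuous (fixedVec x y) := by
    refine (PiLp.continuous_toLp 2 (fun _ : Fin 3 => ℂ)).comp (continuous_pi fun i => ?_)
    fin_cases i
    · exact (by fun_prop : Continuous fun z : Circle => (1 - x : ℂ) * z)
    · exact (by fun_prop : Continuous fun z : Circle => (1 - x - y : ℂ) * z + y)
    · exact continuous_const
  have hnorm : ∀ z, ((‖fixedVec x y z‖ ^ 2 : ℝ) : ℂ) ≠ 0 := fun z =>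
    ofReal_ne_zero.2 (pow_ne_zero 2 (norm_ne_zero_iff.2 (fixedVec_ne_zero hx1 y z)))
  change Continuous fun z => (ℂ ∙ fixedVec x y z).starProjection φ
  simp only [Submodule.starProjection_singleton]
  exact ((hvec.inner continuous_const).div (by fun_prop) hnorm).smul hvec

theorem continuous_fixedPart_circleExp (hx1 : x ≠ 1) (y : ℝ) (φ : CoinSpace) :
    Continuous fun k => fixedPart x y φ (Circle.exp k) :=
  (continuous_fixedPart hx1 y φ).comp Circle.exp.continuous

/-- The limit of the amplitude vector at the position `m` of the walk with coin `coin x y` and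
initial coin state `φ`. -/
noncomputable def limitVec (x y : ℝ) (φ : CoinSpace) (m : ℤ) : CoinSpace :=
  inverseFourier (fun k => fixedPart x y φ (Circle.exp k)) m

theorem state_eq_limitVec_add (h : x ^ 2 + y ^ 2 - x - y + x * y = 0) (hx1 : x ≠ 1)
    (φ : CoinSpace) (m : ℤ) (t : ℕ) :
    state (coin x y) φ t m = limitVec x y φ m +
      (2 * π : ℂ)⁻¹ • ∫ k in -π..π, (momentumStep (coin x y) (Circle.exp k) ^ t)
        (Circle.exp k ^ m • (φ - fixedPart x y φ (Circle.exp k))) := by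
  have hpart := continuous_fixedPart_circleExp hx1 y φ
  have hrest := continuous_momentumStep_pow_apply (coin x y) (g := fun k : ℝ =>
    Circle.exp k ^ m • (φ - fixedPart x y φ (Circle.exp k))) (by fun_prop) t
  have hfixed : Continuous fun k : ℝ => Circle.exp k ^ m • fixedPart x y φ (Circle.exp k) := by
    fun_prop
  rw [state_eq_inverseFourier, limitVec, inverseFourier, inverseFourier, ← smul_add,
    ← intervalIntegral.integral_add (hfixed.intervalIntegrable _ _) (hrest.intervalIntegrable _ _)]
  congr 2
  funext k
  rw [Circle.smul_def, Circle.smul_def, Circle.smul_def, map_smul, map_sub,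
    momentumStep_pow_fixedPart h, ← smul_add, add_sub_cancel]

theorem tendsto_state (h : x ^ 2 + y ^ 2 - x - y + x * y = 0) (hx0 : x ≠ 0) (hx1 : x ≠ 1)
    (φ : CoinSpace) (m : ℤ) :
    Tendsto (fun t : ℕ => state (coin x y) φ t m) atTop (𝓝 (limitVec x y φ m)) := by
  have hx : x ∈ Set.Ico (-(1 / 3)) 1 :=
    ⟨(mem_Icc_of_relation h).1, (mem_Icc_of_relation h).2.lt_of_ne hx1⟩
  have hpart := continuous_fixedPart_circleExp hx1 y φ
  have hdecay := tendsto_intervalIntegral_pow_apply_zero hx hx0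
    (fun k => inner_momentumStep (coin_mem_unitaryGroup h) (Circle.exp k))
    (continuous_momentumStep_pow_apply (coin x y) (g := fun k : ℝ =>
      Circle.exp k ^ m • (φ - fixedPart x y φ (Circle.exp k))) (by fun_prop))
    fun k => momentumStep_momentumStep_of_inner_eq_zero h hx1 (by
      rw [Circle.smul_def, inner_smul_right, inner_fixedVec_sub_fixedPart, mul_zero])
  simpa only [state_eq_limitVec_add h hx1, smul_zero, add_zero] using
    (hdecay.const_smul (2 * π : ℂ)⁻¹).const_add (limitVec x y φ m)

theorem tendsto_prob (h : x ^ 2 + y ^ 2 - x - y + x * y = 0) (hx0 : x ≠ 0) (hx1 : x ≠ 1)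
    (φ : CoinSpace) (m : ℤ) :
    Tendsto (fun t : ℕ => prob (coin x y) φ m t) atTop (𝓝 (‖limitVec x y φ m‖ ^ 2)) := by
  simpa only [prob, EuclideanSpace.norm_sq_eq] using ((tendsto_state h hx0 hx1 φ m).norm.pow 2)

theorem limitVec_zero_eq_zero_iff (hx1 : x ≠ 1) (y : ℝ) (φ : CoinSpace) :
    limitVec x y φ 0 = 0 ↔
      φ 0 * (1 - x) + φ 1 * (1 - x - y) = 0 ∧ φ 2 * (1 - x) + φ 1 * y = 0 := by
  have hpi : (2 * π : ℂ)⁻¹ ≠ 0 :=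
    inv_ne_zero (mul_ne_zero two_ne_zero (ofReal_ne_zero.2 Real.pi_ne_zero))
  have hneg_pi : -π < π := neg_lt_self Real.pi_pos
  have hpart := continuous_fixedPart_circleExp hx1 y φ
  have hexp_pi : Circle.exp π = -1 :=
    Circle.ext (by rw [Circle.coe_exp, exp_pi_mul_I, Circle.coe_neg, Circle.coe_one])
  have hone : (1 : Circle) ∈ Circle.exp '' Set.Icc (-π) π :=
    ⟨0, ⟨neg_nonpos.2 Real.pi_nonneg, Real.pi_nonneg⟩, Circle.exp_zero⟩
  have hneg_one : (-1 : Circle) ∈ Circle.exp '' Set.Icc (-π) π :=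
    ⟨π, Set.right_mem_Icc.2 hneg_pi.le, hexp_pi⟩
  rw [← forall_inner_fixedVec_eq_zero_iff hone hneg_one, Set.forall_mem_image, limitVec,
    inverseFourier, smul_eq_zero_iff_right hpi]
  simp only [zpow_zero, one_smul, ← fixedPart_eq_zero_iff]
  exact intervalIntegral_starProjection_eq_zero_iff hneg_pi hpart.continuousOn

theorem localizesAt_iff_limitVec_ne_zero (h : x ^ 2 + y ^ 2 - x - y + x * y = 0) (hx0 : x ≠ 0)
    (hx1 : x ≠ 1) (φ : CoinSpace) (m : ℤ) :
    LocalizesAt (coin x y) φ m ↔ limitVec x y φ m ≠ 0 := by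
  have hlim := tendsto_prob h hx0 hx1 φ m
  refine ⟨?_, fun hne => ⟨_, by positivity, hlim⟩⟩
  rintro ⟨p, hp, hprob⟩ hzero
  simp_all [tendsto_nhds_unique hprob hlim]

theorem tendsto_prob_zero_iff (h : x ^ 2 + y ^ 2 - x - y + x * y = 0) (hx0 : x ≠ 0)
    (hx1 : x ≠ 1) (φ : CoinSpace) (m : ℤ) :
    Tendsto (fun t : ℕ => prob (coin x y) φ m t) atTop (𝓝 0) ↔ limitVec x y φ m = 0 := by
  have hlim := tendsto_prob h hx0 hx1 φ m
  refine ⟨fun hzero => ?_, fun hzero => ?_⟩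
  · simpa only [pow_eq_zero_iff two_ne_zero, norm_eq_zero] using tendsto_nhds_unique hlim hzero
  · simpa only [hzero, norm_zero, zero_pow two_ne_zero] using hlim

end Limit

section EscapeVec

variable {x : ℝ}

theorem exists_eq_smul_escapeVec_iff (hx1 : x ≠ 1) (y : ℝ) (φ : CoinSpace) :
    (∃ c : ℂ, φ = c • escapeVec x y) ↔
      φ 0 * (1 - x) + φ 1 * (1 - x - y) = 0 ∧ φ 2 * (1 - x) + φ 1 * y = 0 := by
  have hne : (1 - x : ℂ) ≠ 0 := by exact_mod_cast sub_ne_zero.2 hx1.symm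
  constructor
  · rintro ⟨c, rfl⟩
    simp only [escapeVec, PiLp.smul_apply, Matrix.cons_val_zero, Matrix.cons_val_one,
      Matrix.cons_val, smul_eq_mul]
    constructor <;> ring
  · rintro ⟨hA, hB⟩
    refine ⟨-φ 1 / (1 - x), ?_⟩
    ext i
    fin_cases i <;> simp [escapeVec] <;> field_simp
    · linear_combination hA
    · ring
    · linear_combination hB

theorem norm_escapeVec (x y : ℝ) :
    ‖escapeVec x y‖ = √((1 - x - y) ^ 2 + (1 - x) ^ 2 + y ^ 2) := by
  have hreal : escapeVec x y = !₂[((1 - x - y : ℝ) : ℂ), ((-(1 - x) : ℝ) : ℂ), (y : ℂ)] := by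
    simp [escapeVec]
  simp only [hreal, EuclideanSpace.norm_eq, Fin.sum_univ_three, Matrix.cons_val_zero,
    Matrix.cons_val_one, Matrix.cons_val, norm_real, Real.norm_eq_abs, sq_abs, neg_sq]

end EscapeVec

end ThreeStateWalk

theorem mainTheorem3 (x y : ℝ) (hC : ThreeStateWalk.coin x y ∈ ThreeStateWalk.coinsX)
    (hx0 : x ≠ 0) (hx1 : x ≠ 1) (α β γ : ℂ)
    (hnorm : ‖α‖ ^ 2 + ‖β‖ ^ 2 + ‖γ‖ ^ 2 = 1) :
    List.TFAE
      [Filter.Tendsto (fun t : ℕ => ThreeStateWalk.prob (ThreeStateWalk.coin x y) !₂[α, β, γ] 0 t)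
          Filter.atTop (nhds 0),
        ∃ c : ℂ, !₂[α, β, γ] = c • ThreeStateWalk.escapeVec x y,
        ∃ u : ℂ, ‖u‖ = 1 ∧ !₂[α, β, γ] =
          (u / (Real.sqrt ((1 - x - y) ^ 2 + (1 - x) ^ 2 + y ^ 2) : ℂ)) •
            ThreeStateWalk.escapeVec x y,
        α * (1 - x) + β * (1 - x - y) = 0 ∧ γ * (1 - x) + β * y = 0] ∧
    ((¬ ∃ c : ℂ, !₂[α, β, γ] = c • ThreeStateWalk.escapeVec x y) →
      ThreeStateWalk.LocalizesAt (ThreeStateWalk.coin x y) !₂[α, β, γ] 0) := by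
  have h := ThreeStateWalk.coin_mem_coinsX_iff.1 hC
  have hescape := ThreeStateWalk.exists_eq_smul_escapeVec_iff hx1 y !₂[α, β, γ]
  have hlimit := ThreeStateWalk.limitVec_zero_eq_zero_iff hx1 y !₂[α, β, γ]
  have hunit : ‖(!₂[α, β, γ] : ThreeStateWalk.CoinSpace)‖ = 1 := by
    rw [← sq_eq_sq₀ (norm_nonneg _) zero_le_one, one_pow, EuclideanSpace.norm_sq_eq,
      Fin.sum_univ_three]
    exact hnorm
  refine ⟨?_, fun hno => (ThreeStateWalk.localizesAt_iff_limitVec_ne_zero h hx0 hx1 _ 0).2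
    fun hzero => hno (hescape.2 (hlimit.1 hzero))⟩
  tfae_have 1 ↔ 4 := (ThreeStateWalk.tendsto_prob_zero_iff h hx0 hx1 _ 0).trans hlimit
  tfae_have 2 ↔ 4 := hescape
  tfae_have 2 ↔ 3 := by
    rw [← ThreeStateWalk.norm_escapeVec]
    exact exists_eq_smul_iff_exists_norm_eq_one hunit
  tfae_finish
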